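/- Let $\mathbb{S}^n$ be the space of real symmetric $n\times n$ matrices, $\mathbb{S}^n_+$ its cone of positive semidefinite matrices, and $A\bullet B=\sum_{i,j}A_{ij}B_{ij}$. Let $A_0,A_1,\dots,A_m\in\mathbb{S}^n$, $b\in\mathbb{R}^m$, $K=\{1,\dots,m\}$, and for $k\in K$ let $E_k:[0,\infty)\to\mathbb{S}^n$ be continuous at $0$ with $E_k(0)=O$. Consider \begin{align*} (P)\quad & \sup_{y,Z}\Big\{b^Ty : A_0-\sum_{k\in K}y_kA_k=Z,\ y\in\mathbb{R}^m,\ Z\in\mathbb{S}^n_+\Big\},\\ (D)\quad & \inf_X\{A_0\bullet X : A_k\bullet X=b_k\ (k\in K),\ X\in\mathbb{S}^n_+\},\\ (D_t)\quad & \inf_X\{A_0\bullet X : (A_k+E_k(t))\bullet X=b_k\ (k\in K),\ X\in\mathbb{S}^n_+\}. \end{align*} A face of $\mathbb{S}^n_+$ is a convex subset $F$ of $\mathbb{S}^n_+$ such that, whenever $X_1,X_2\in\mathbb{S}^n_+$ and the open segment $(X_1,X_2)$ meets $F$, both $X_1$ and $X_2$ belong to $F$. Let $F_{\min}$ and $F^t_{\min}$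 be the minimal faces of $(D)$ and $(D_t)$, i.e. the intersection of all faces of $\mathbb{S}^n_+$ that contain the feasible region of the problem. For $F\subseteq\mathbb{S}^n_+$ put $F^\perp=\{Z\in\mathbb{S}^n : Z\bullet X=0\ \text{for all } X\in F\}$. Assume: 1. $(D)$ is feasible, and $(P)$ is strictly feasible, i.e. has a feasible point $(y,Z)$ with $Z$ positive definite; 2. $A_1,\dots,A_m$ are linearly independent; 3. $(D_t)$ is feasible for all sufficiently small $t>0$; 4. (rank condition) for an orthogonal matrix $Q$ and an integer $0\le r\le n$ with $$F_{\min}=\left\{Q\begin{pmatrix}O&O\\O&X\end{pmatrix}Q^T : X\in\mathbb{S}^r_+\right\},$$ there is $\delta>0$ such that for all $0\le t\le\delta$ $$\dim\operatorname{span}\{(Q^T(A_k+E_k(t))Q)_3 : k\in K\}=\dim\operatorname{span}\{(Q^TA_kQ)_3 : k\in K\},$$ where $M_3$ denotes the right bottom $r\times r$ block of $M\in\mathbb{S}^n$; 5. $F^t_{\min}\subseteq F_{\min}$ for all sufficiently small $t>0$. Then for all sufficiently small $t>0$ the system $$\sum_{k\in K}y_k\,(A_k+E_k(t))\in(\mathbb{S}^n_++F_{\min}^\perp)\setminus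 F_{\min}^\perp,\qquad b^Ty=0$$ has no solution $y\in\mathbb{R}^m$, and $F^t_{\min}=F_{\min}$. -/

import Mathlib

open scoped Pointwise

namespace SDP

/-- Real `n × n` matrices; the symmetric ones among them form `S^n`. -/
abbrev Mat (n : ℕ) : Type := Matrix (Fin n) (Fin n) ℝ

/-- The inner product `A • B = ∑_{i,j} A_ij B_ij`. -/
def dot {n : ℕ} (A B : Mat n) : ℝ := ∑ i, ∑ j, A i j * B i j

/-- The cone `S^n_+` of (symmetric) positive semidefinite matrices. -/
def psdCone (n : ℕ) : Set (Mat n) := {X | X.PosSemidef}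

/-- `F^⊥ = {Z ∈ S^n : Z • X = 0 for all X ∈ F}`. -/
def perp {n : ℕ} (F : Set (Mat n)) : Set (Mat n) :=
  {Z | Z.IsSymm ∧ ∀ X ∈ F, dot Z X = 0}

/-- `F` is a face of the convex set `C`: a convex subset of `C` that contains both end points of
every open segment with end points in `C` that meets `F`. -/
def IsFace {n : ℕ} (C F : Set (Mat n)) : Prop :=
  F ⊆ C ∧ Convex ℝ F ∧
    ∀ X₁ ∈ C, ∀ X₂ ∈ C, (openSegment ℝ X₁ X₂ ∩ F).Nonempty → X₁ ∈ F ∧ X₂ ∈ F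

/-- The feasible region of `inf {A₀ • X : A_k • X = b_k (k ∈ K), X ∈ S^n_+}`. -/
def feasD {n m : ℕ} (A : Fin m → Mat n) (b : Fin m → ℝ) : Set (Mat n) :=
  {X | X ∈ psdCone n ∧ ∀ k, dot (A k) X = b k}

/-- The minimal face: the intersection of all faces of `S^n_+` containing the feasible region. -/
def minFace {n m : ℕ} (A : Fin m → Mat n) (b : Fin m → ℝ) : Set (Mat n) :=
  ⋂₀ {F | IsFace (psdCone n) F ∧ feasD A b ⊆ F}

/-- Strict feasibility of `sup {bᵀy : A₀ - ∑ y_k A_k = Z, y ∈ ℝ^m, Z ∈ S^n_+}`. -/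
def StrictlyFeasibleP {n m : ℕ} (A₀ : Mat n) (A : Fin m → Mat n) : Prop :=
  ∃ (y : Fin m → ℝ) (Z : Mat n), A₀ - ∑ k, y k • A k = Z ∧ Z.PosDef

/-- The identification of the row indices of a `p + r` block partition with `Fin n`. -/
def blockEquiv {n p r : ℕ} (h : p + r = n) : Fin p ⊕ Fin r ≃ Fin n :=
  finSumFinEquiv.trans (finCongr h)

/-- The right bottom `r × r` block `M₃` of `M`. -/
def block3 {n p r : ℕ} (h : p + r = n) (M : Mat n) : Mat r :=
  (M.submatrix (blockEquiv h) (blockEquiv h)).toBlocks₂₂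

/-- The `n × n` matrix whose right bottom block is `X` and whose other blocks vanish. -/
def embed3 {n p r : ℕ} (h : p + r = n) (X : Mat r) : Mat n :=
  (Matrix.fromBlocks 0 0 0 X).submatrix (blockEquiv h).symm (blockEquiv h).symm

/-- The face `F` is `{Q (O O; O X) Qᵀ : X ∈ S^r_+}`. -/
def RepresentsFace {n p r : ℕ} (h : p + r = n) (Q : Mat n) (F : Set (Mat n)) : Prop :=
  F = {Y | ∃ X ∈ psdCone r, Y = Q * embed3 h X * Q.transpose}

/-- `rank ⟨B_1, …, B_m⟩`, the dimension of the span. -/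
noncomputable def rankSpan {r m : ℕ} (B : Fin m → Mat r) : ℕ :=
  Module.finrank ℝ (Submodule.span ℝ (Set.range B))

/-- The rank condition for the family `A_k + E_k(t)`: for an orthogonal matrix `Q` associated to
the minimal face of the unperturbed problem, the rank of the right bottom blocks is preserved
on some interval `[0, δ]`. -/
def RankCondition {n m : ℕ} (A : Fin m → Mat n) (b : Fin m → ℝ) (E : Fin m → ℝ → Mat n) : Prop :=
  ∃ (p r : ℕ) (h : p + r = n) (Q : Mat n),
    Q ∈ Matrix.orthogonalGroup (Fin n) ℝ ∧ RepresentsFace h Q (minFace A b) ∧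
    ∃ δ : ℝ, 0 < δ ∧ ∀ t : ℝ, 0 ≤ t → t ≤ δ →
      rankSpan (fun k => block3 h (Q.transpose * (A k + E k t) * Q)) =
        rankSpan (fun k => block3 h (Q.transpose * A k * Q))

end SDP

namespace SDP

open Matrix Filter Topology

variable {n m r p : ℕ}

/-! Compressing by `Q` turns problems whose feasible points lie in `F_min` into systems `B_k(t) • Y
= b_k` over `S^r_+`. Such a feasible system either has a positive definite solution or admits a
reducing `y`: `∑ y_k B_k(t)` is nonzero and positive semidefinite with `bᵀy = 0`
(`exists_posDef_or_exists_reducing`). At `t = 0` minimality of the face rules out a reducing `y`, so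
a positive definite solution exists. This persists for small `t` (`eventually_not_exists_reducing`):
the rank condition lets a fixed subset of the `B_k(t)` serve as a basis of their span, and
compactness of the unit sphere of coefficients excludes a reducing `y`. A solution of the system in
the statement would compress to one, so there is none. The alternative then gives a positive
definite solution at `t`, that is, a feasible point in the relative interior of `F_min`, and every
face containing it contains `F_min`. -/

lemma dot_eq_trace (A B : Mat n) : dot A B = (Aᵀ * B).trace := by
  simp only [dot, Matrix.trace, Matrix.diag, Matrix.mul_apply, Matrix.transpose_apply]
  exact Finset.sum_comm

/-- The pairing `A • B` as a bilinear form. -/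
def dotForm (n : ℕ) : Mat n →ₗ[ℝ] Mat n →ₗ[ℝ] ℝ :=
  LinearMap.mk₂ ℝ dot
    (fun A A' B => by simp [dot, add_mul, Finset.sum_add_distrib])
    (fun c A B => by simp [dot, mul_assoc, Finset.mul_sum])
    (fun A B B' => by simp [dot, mul_add, Finset.sum_add_distrib])
    (fun c A B => by simp [dot, mul_left_comm, Finset.mul_sum])

@[simp] lemma dotForm_apply (A B : Mat n) : dotForm n A B = dot A B := rfl

lemma dot_add_right (A B C : Mat n) : dot A (B + C) = dot A B + dot A C :=
  map_add (dotForm n A) B C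

lemma dot_smul_right (c : ℝ) (A B : Mat n) : dot A (c • B) = c * dot A B :=
  map_smul (dotForm n A) c B

lemma dot_sum_smul_left {ι : Type*} [Fintype ι] (y : ι → ℝ) (B : ι → Mat n) (X : Mat n) :
    dot (∑ k, y k • B k) X = ∑ k, y k * dot (B k) X := by
  change dotForm n _ X = _
  simp [map_sum, LinearMap.sum_apply]

lemma dot_transpose_right {A : Mat n} (hA : A.IsSymm) (B : Mat n) : dot A Bᵀ = dot A B := by
  rw [dot_eq_trace, dot_eq_trace, hA.eq, ← Matrix.trace_transpose, Matrix.transpose_mul,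
    Matrix.transpose_transpose, hA.eq, Matrix.trace_mul_comm]

lemma dot_one (A : Mat n) : dot A 1 = A.trace := by
  rw [dot_eq_trace, mul_one, Matrix.trace_transpose]

lemma dot_vecMulVec (A : Mat n) (x : Fin n → ℝ) : dot A (vecMulVec x x) = x ⬝ᵥ A *ᵥ x := by
  simp only [dot, vecMulVec_apply, dotProduct, mulVec, Finset.mul_sum]
  exact Finset.sum_congr rfl fun i _ => Finset.sum_congr rfl fun j _ => by ring

/-- By the Schur product theorem: the pairing is the quadratic form of the Hadamard product at the
all-ones vector. -/
lemma dot_nonneg {A B : Mat n} (hA : A.PosSemidef) (hB : B.PosSemidef) : 0 ≤ dot A B := by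
  have := (hA.hadamard hB).dotProduct_mulVec_nonneg 1
  simpa [dot, dotProduct, mulVec] using this

lemma isHermitian_of_isSymm {A : Mat n} (hA : A.IsSymm) : A.IsHermitian := by
  rw [Matrix.IsHermitian, conjTranspose_eq_transpose_of_trivial]; exact hA

lemma isSymm_of_isHermitian {A : Mat n} (hA : A.IsHermitian) : A.IsSymm := by
  rw [Matrix.IsHermitian, conjTranspose_eq_transpose_of_trivial] at hA; exact hA

lemma posSemidef_of_isSymm {A : Mat n} (hA : A.IsSymm) (h : ∀ x, 0 ≤ x ⬝ᵥ A *ᵥ x) :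
    A.PosSemidef :=
  .of_dotProduct_mulVec_nonneg (isHermitian_of_isSymm hA) (by simpa using h)

lemma isSymm_sum_smul {ι : Type*} [Fintype ι] {B : ι → Mat n} (hB : ∀ k, (B k).IsSymm)
    (y : ι → ℝ) : (∑ k, y k • B k).IsSymm := by
  rw [Matrix.IsSymm, Matrix.transpose_sum]
  exact Finset.sum_congr rfl fun k _ => by rw [transpose_smul, (hB k).eq]

/-! ### Positive quadratic forms as an open convex cone -/

/-- The not necessarily symmetric matrices with positive definite quadratic form. -/
def posQuad (n : ℕ) : Set (Mat n) := {M | ∀ x : Fin n → ℝ, x ≠ 0 → 0 < x ⬝ᵥ M *ᵥ x}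

lemma posQuad_of_posDef {M : Mat n} (hM : M.PosDef) : M ∈ posQuad n := fun x hx => by
  simpa using hM.dotProduct_mulVec_pos hx

lemma isOpen_posQuad : IsOpen (posQuad n) := by
  -- By homogeneity unit vectors suffice, and their compactness makes the condition open.
  have hS : posQuad n = {M | ∀ x ∈ Metric.sphere (0 : Fin n → ℝ) 1, 0 < x ⬝ᵥ M *ᵥ x} := by
    ext M
    refine ⟨fun h x hx => h x ?_, fun h x hx => ?_⟩
    · rintro rfl; simp at hx
    · have hn : 0 < ‖x‖ := norm_pos_iff.2 hx
      have := h (‖x‖⁻¹ • x) (by simp [norm_smul, hn.ne'])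
      rw [mulVec_smul, smul_dotProduct, dotProduct_smul, smul_smul, smul_eq_mul] at this
      exact pos_of_mul_pos_right this (by positivity)
  rw [hS, isOpen_iff_mem_nhds]
  intro M hM
  refine (isCompact_sphere (0 : Fin n → ℝ) 1).eventually_forall_of_forall_eventually
    (P := fun M x => 0 < x ⬝ᵥ M *ᵥ x) fun x hx => ?_
  have hc : Continuous fun z : Mat n × (Fin n → ℝ) => z.2 ⬝ᵥ z.1 *ᵥ z.2 := by fun_prop
  exact hc.continuousAt.eventually (lt_mem_nhds (hM x hx))

lemma convex_posQuad : Convex ℝ (posQuad n) := by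
  rw [convex_iff_forall_pos]
  intro M hM N hN a b ha hb _ x hx
  rw [add_mulVec, smul_mulVec, smul_mulVec, dotProduct_add, dotProduct_smul, dotProduct_smul]
  exact add_pos (mul_pos ha (hM x hx)) (mul_pos hb (hN x hx))

lemma smul_mem_posQuad {M : Mat n} (hM : M ∈ posQuad n) {c : ℝ} (hc : 0 < c) :
    c • M ∈ posQuad n := fun x hx => by
  rw [smul_mulVec, dotProduct_smul]; exact mul_pos hc (hM x hx)

/-- A positive definite matrix can be moved a little in every symmetric direction. -/
lemma exists_posSemidef_add_smul {Y N : Mat n} (hY : Y.PosDef) (hN : N.IsSymm) :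
    ∃ ε : ℝ, 0 < ε ∧ (Y + ε • N).PosSemidef := by
  have hc : Continuous fun ε : ℝ => Y + ε • N := by fun_prop
  have h0 : ∀ᶠ ε in 𝓝 (0 : ℝ), Y + ε • N ∈ posQuad n :=
    hc.continuousAt.eventually (isOpen_posQuad.mem_nhds (by simpa using posQuad_of_posDef hY))
  obtain ⟨ε, hε, hpos⟩ :=
    ((h0.filter_mono nhdsWithin_le_nhds).and (self_mem_nhdsWithin (s := Set.Ioi (0 : ℝ)))).exists
  refine ⟨ε, hpos, posSemidef_of_isSymm ?_ fun x => ?_⟩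
  · exact (isSymm_of_isHermitian hY.isHermitian).add (hN.smul ε)
  · rcases eq_or_ne x 0 with rfl | hx
    · simp
    · exact (hε x hx).le

lemma dot_pos {C Y : Mat n} (hC : C.PosSemidef) (hC0 : C ≠ 0) (hY : Y.PosDef) : 0 < dot C Y := by
  -- `Y - ε • 1` is still positive semidefinite, whence `C • Y ≥ ε tr C > 0`.
  obtain ⟨ε, hε, h⟩ := exists_posSemidef_add_smul hY (N := -1) (by simp [Matrix.IsSymm])
  have h1 := dot_nonneg hC h
  have h2 : 0 < C.trace := hC.trace_nonneg.lt_of_ne fun h => hC0 (hC.trace_eq_zero_iff.1 h.symm)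
  rw [smul_neg, ← neg_smul, dot_add_right, dot_smul_right, dot_one] at h1
  nlinarith [mul_pos hε h2]

/-! ### Theorem of the alternative -/

/-- Theorem of the alternative for a feasible semidefinite system: either it has a positive
definite solution or its solution set is cut out by a nontrivial facial reduction. -/
theorem exists_posDef_or_exists_reducing {B : Fin m → Mat r} (hB : ∀ k, (B k).IsSymm)
    {b : Fin m → ℝ} {Y₀ : Mat r} (hY₀ : Y₀.PosSemidef) (hb : ∀ k, dot (B k) Y₀ = b k) :
    (∃ Y : Mat r, Y.PosDef ∧ ∀ k, dot (B k) Y = b k) ∨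
      ∃ y : Fin m → ℝ, (∑ k, y k • B k).PosSemidef ∧ (∑ k, y k • B k) ≠ 0 ∧
        ∑ k, b k * y k = 0 := by
  -- Dropping symmetry makes the cone open in the whole matrix space, as separation requires; a
  -- common point is symmetrized afterwards, which changes neither its quadratic form nor its
  -- pairings with the symmetric `B k`.
  by_cases hdis : Disjoint (posQuad r) {M | ∀ k, dot (B k) M = b k}
  swap
  · left
    obtain ⟨M, hM, hMb⟩ := Set.not_disjoint_iff.1 hdis
    have hs : ((1 / 2 : ℝ) • (M + Mᵀ)).IsSymm := by
      rw [Matrix.IsSymm, transpose_smul, transpose_add, transpose_transpose, add_comm]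
    refine ⟨(1 / 2 : ℝ) • (M + Mᵀ),
      .of_dotProduct_mulVec_pos (isHermitian_of_isSymm hs) fun x hx => ?_, fun k => ?_⟩
    · have h := hM x hx
      have ht : x ⬝ᵥ Mᵀ *ᵥ x = x ⬝ᵥ M *ᵥ x := by
        rw [mulVec_transpose, dotProduct_comm, ← dotProduct_mulVec]
      rw [star_trivial, smul_mulVec, add_mulVec, dotProduct_smul, dotProduct_add, ht, smul_eq_mul]
      linarith
    · rw [dot_smul_right, dot_add_right, dot_transpose_right (hB k), hMb k]; ring
  right
  have hconv : Convex ℝ {M : Mat r | ∀ k, dot (B k) M = b k} := by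
    intro M hM N hN s t _ _ hst k
    rw [dot_add_right, dot_smul_right, dot_smul_right, hM k, hN k, ← add_mul, hst, one_mul]
  obtain ⟨f, u, hfu, huf⟩ :=
    geometric_hahn_banach_open convex_posQuad isOpen_posQuad hconv hdis
  have h1 : (1 : Mat r) ∈ posQuad r := posQuad_of_posDef PosDef.one
  -- A functional bounded above on a cone is nonpositive there: otherwise the chosen multiple of `M`
  -- has value `|u| + f M > u`.
  have hneg : ∀ M ∈ posQuad r, f M ≤ 0 := by
    intro M hM
    by_contra! h
    have := hfu ((|u| / f M + 1) • M) (smul_mem_posQuad hM (by positivity))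
    rw [map_smul, smul_eq_mul, add_mul, div_mul_cancel₀ _ h.ne'] at this
    linarith [le_abs_self u]
  have hu : 0 ≤ u := by
    by_contra! h
    -- This multiple of `1` is small enough that `f` stays above the negative number `u` on it.
    have hpos : 0 < -u / (|f 1| + 1) := div_pos (by linarith) (by positivity)
    have h2 := hfu _ (smul_mem_posQuad h1 hpos)
    rw [map_smul, smul_eq_mul, div_mul_eq_mul_div, div_lt_iff₀ (by positivity)] at h2
    nlinarith [neg_abs_le (f 1), abs_nonneg (f 1)]
  have hpsd : ∀ M : Mat r, M.PosSemidef → f M ≤ 0 := by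
    intro M hM
    have hε : ∀ ε : ℝ, 0 < ε → f M + ε * f 1 ≤ 0 := by
      intro ε hε
      have := hneg (M + ε • 1) (posQuad_of_posDef (PosDef.posSemidef_add hM (PosDef.one.smul hε)))
      simpa using this
    have hc : Tendsto (fun ε : ℝ => f M + ε * f 1) (𝓝[>] 0) (𝓝 (f M + 0 * f 1)) :=
      Continuous.continuousWithinAt (by fun_prop)
    have := le_of_tendsto hc (eventually_nhdsWithin_of_forall hε)
    simpa using this
  have hY0 : f Y₀ = 0 := le_antisymm (hpsd _ hY₀) (hu.trans (huf _ hb))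
  -- `f` is bounded below on the affine solution set, hence constant along its directions; so `-f`
  -- is a combination of the constraint functionals, whose coefficients are the reducing `y`.
  have hker : ∀ N : Mat r, (∀ k, dot (B k) N = 0) → f N = 0 := by
    intro N hN
    by_contra h
    have := huf (Y₀ + ((-1) / f N) • N) fun k => by
      rw [dot_add_right, dot_smul_right, hN k, hb k, mul_zero, add_zero]
    rw [map_add, map_smul, smul_eq_mul, hY0, div_mul_cancel₀ _ h] at this
    linarith
  have hmem : (-f : Mat r →L[ℝ] ℝ).toLinearMap ∈
      Submodule.span ℝ (Set.range fun k => dotForm r (B k)) := by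
    refine mem_span_of_iInf_ker_le_ker fun N hN => ?_
    simp only [Submodule.mem_iInf, LinearMap.mem_ker, dotForm_apply] at hN
    simp [hker N hN]
  obtain ⟨y, hy⟩ := (Submodule.mem_span_range_iff_exists_fun ℝ).1 hmem
  have hyM : ∀ M : Mat r, dot (∑ k, y k • B k) M = -f M := by
    intro M
    have := LinearMap.congr_fun hy M
    simpa [dot_sum_smul_left, LinearMap.sum_apply] using this
  refine ⟨y, posSemidef_of_isSymm (isSymm_sum_smul hB y) fun x => ?_, fun h0 => ?_, ?_⟩
  · rw [← dot_vecMulVec, hyM]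
    have := hpsd _ (by simpa using posSemidef_vecMulVec_self_star x)
    linarith
  · have h2 := hyM 1
    have h3 := hfu 1 h1
    have h4 := huf Y₀ hb
    rw [h0, dot_one, trace_zero] at h2
    linarith
  · have := hyM Y₀
    rw [dot_sum_smul_left, hY0, neg_zero] at this
    rw [← this]
    exact Finset.sum_congr rfl fun k _ => by rw [hb k, mul_comm]

/-! ### Stability under rank-preserving perturbations -/

/-- Infeasibility of the facial reduction system is stable under perturbations that preserve the
rank of the constraint matrices and the consistency of the equations. -/
theorem eventually_not_exists_reducing {l : Filter ℝ} {B₀ : Fin m → Mat r}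
    {B : ℝ → Fin m → Mat r}
    (hB₀ : ∀ k, (B₀ k).IsSymm) {b : Fin m → ℝ} (hlim : Tendsto B l (𝓝 B₀))
    (hrank : ∀ᶠ t in l, rankSpan (B t) = rankSpan B₀)
    {Y₀ : Mat r} (hY₀ : Y₀.PosDef) (hb : ∀ k, dot (B₀ k) Y₀ = b k)
    (hfeas : ∀ᶠ t in l, ∃ Y : Mat r, ∀ k, dot (B t k) Y = b k) :
    ∀ᶠ t in l, ¬ ∃ y : Fin m → ℝ, (∑ k, y k • B t k).PosSemidef ∧ (∑ k, y k • B t k) ≠ 0 ∧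
      ∑ k, b k * y k = 0 := by
  let _ := Matrix.normedAddCommGroup (m := Fin r) (n := Fin r) (α := ℝ)
  let _ := Matrix.normedSpace (m := Fin r) (n := Fin r) (α := ℝ) (R := ℝ)
  -- Working with a basis of the span makes nonzero combinations correspond to nonzero coefficients,
  -- which can be normalized to the compact sphere.
  obtain ⟨κ, a, ha, hspan, hli⟩ := exists_linearIndependent' ℝ B₀
  have : Finite κ := Finite.of_injective a ha
  let _ : Fintype κ := Fintype.ofFinite κ
  have hlim' : Tendsto (fun t => B t ∘ a) l (𝓝 (B₀ ∘ a)) :=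
    ((continuous_pi fun k => continuous_apply (a k)).tendsto B₀).comp hlim
  have hli' : ∀ᶠ t in l, LinearIndependent ℝ (B t ∘ a) := hlim'.eventually hli.eventually
  have htube : ∀ᶠ t in l, ∀ z ∈ Metric.sphere (0 : κ → ℝ) 1,
      ¬ ((∀ x, 0 ≤ x ⬝ᵥ (∑ k, z k • (B t ∘ a) k) *ᵥ x) ∧ ∑ k, z k * b (a k) = 0) := by
    refine hlim'.eventually
      ((isCompact_sphere (0 : κ → ℝ) 1).eventually_forall_of_forall_eventually
      (P := fun (G : κ → Mat r) z =>
        ¬ ((∀ x, 0 ≤ x ⬝ᵥ (∑ k, z k • G k) *ᵥ x) ∧ ∑ k, z k * b (a k) = 0)) fun z hz => ?_)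
    by_cases hbz : ∑ k, z k * b (a k) = 0
    · have hC0 : ∑ k, z k • (B₀ ∘ a) k ≠ 0 := fun h => by
        have : z = 0 := funext (Fintype.linearIndependent_iff.1 hli z h)
        simp [this] at hz
      have hx : ∃ x, x ⬝ᵥ (∑ k, z k • (B₀ ∘ a) k) *ᵥ x < 0 := by
        -- A nonzero positive semidefinite combination pairs strictly positively with `Y₀`, yet this
        -- pairing is `∑ z_k b_(a k) = 0`.
        by_contra! hx
        have := dot_pos (posSemidef_of_isSymm (isSymm_sum_smul (fun k => hB₀ (a k)) z) hx) hC0 hY₀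
        rw [dot_sum_smul_left] at this
        simp [hb, hbz] at this
      obtain ⟨x, hx⟩ := hx
      have hc : Continuous fun q : (κ → Mat r) × (κ → ℝ) =>
          x ⬝ᵥ (∑ k, q.2 k • q.1 k) *ᵥ x := by fun_prop
      filter_upwards [hc.continuousAt.eventually (gt_mem_nhds hx)] with q hq h
      exact (h.1 x).not_gt hq
    · have hc : Continuous fun q : (κ → Mat r) × (κ → ℝ) => ∑ k, q.2 k * b (a k) := by fun_prop
      filter_upwards [hc.continuousAt.eventually (isOpen_ne.mem_nhds hbz)] with q hq h
      exact hq h.2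
  filter_upwards [hli', htube, hrank, hfeas] with t hit ht hrt hft
  rintro ⟨y, hpsd, hne, hby⟩
  obtain ⟨Y, hY⟩ := hft
  -- The rank condition enters here: the perturbed subfamily is still independent, and its size
  -- equals the unchanged rank.
  have hspan_t : Submodule.span ℝ (Set.range (B t ∘ a)) = Submodule.span ℝ (Set.range (B t)) := by
    refine Submodule.eq_of_le_of_finrank_eq
      (Submodule.span_mono (Set.range_comp_subset_range _ _)) ?_
    change _ = rankSpan (B t)
    rw [hrt, rankSpan, ← hspan, finrank_span_eq_card hit, finrank_span_eq_card hli]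
  have hmem : ∑ k, y k • B t k ∈ Submodule.span ℝ (Set.range (B t ∘ a)) := by
    rw [hspan_t]
    exact Submodule.sum_mem _ fun k _ =>
      Submodule.smul_mem _ _ (Submodule.subset_span (Set.mem_range_self k))
  obtain ⟨z, hz⟩ := (Submodule.mem_span_range_iff_exists_fun ℝ).1 hmem
  have hz0 : z ≠ 0 := by
    rintro rfl
    exact hne (by simpa using hz.symm)
  have hn : 0 < ‖z‖ := norm_pos_iff.2 hz0
  -- Consistency makes `bᵀy` depend only on the matrix `∑ y_k B_k(t)`: it is the pairing with the
  -- solution `Y`.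
  have hbz : ∑ k, z k * b (a k) = 0 := by
    have h := congrArg (fun C => dot C Y) hz
    simp only [dot_sum_smul_left, Function.comp_apply, hY] at h
    rw [h, ← hby]
    exact Finset.sum_congr rfl fun k _ => mul_comm _ _
  refine ht (‖z‖⁻¹ • z) (by simp [norm_smul, hn.ne']) ⟨fun x => ?_, ?_⟩
  · have : ∑ k, (‖z‖⁻¹ • z) k • (B t ∘ a) k = ‖z‖⁻¹ • ∑ k, y k • B t k := by
      rw [← hz, Finset.smul_sum]
      exact Finset.sum_congr rfl fun k _ => by rw [Pi.smul_apply, smul_eq_mul, mul_smul]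
    rw [this, smul_mulVec, dotProduct_smul]
    exact mul_nonneg (inv_nonneg.2 hn.le) (by simpa using hpsd.dotProduct_mulVec_nonneg x)
  · simp only [Pi.smul_apply, smul_eq_mul, mul_assoc, ← Finset.mul_sum, hbz, mul_zero]

/-! ### Compression to the face and dilation back -/

/-- The compression `M ↦ (Qᵀ M Q)₃`. -/
def compress (h : p + r = n) (Q : Mat n) : Mat n →ₗ[ℝ] Mat r where
  toFun M := block3 h (Qᵀ * M * Q)
  map_add' M N := by rw [mul_add, add_mul]; rfl
  map_smul' c M := by rw [Matrix.mul_smul, Matrix.smul_mul]; rfl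

lemma compress_apply (h : p + r = n) (Q M : Mat n) :
    compress h Q M = block3 h (Qᵀ * M * Q) := rfl

/-- The dilation `X ↦ Q (O O; O X) Qᵀ`. -/
def dilate (h : p + r = n) (Q : Mat n) : Mat r →ₗ[ℝ] Mat n where
  toFun X := Q * embed3 h X * Qᵀ
  map_add' X Y := by
    have : embed3 h (X + Y) = embed3 h X + embed3 h Y := by
      ext i j
      rcases hi : (blockEquiv h).symm i with i' | i' <;>
        rcases hj : (blockEquiv h).symm j with j' | j' <;> simp [embed3, hi, hj]
    rw [this, mul_add, add_mul]
  map_smul' c X := by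
    have : embed3 h (c • X) = c • embed3 h X := by
      ext i j
      rcases hi : (blockEquiv h).symm i with i' | i' <;>
        rcases hj : (blockEquiv h).symm j with j' | j' <;> simp [embed3, hi, hj]
    rw [this, Matrix.mul_smul, Matrix.smul_mul]; rfl

lemma dot_embed3 (h : p + r = n) (M : Mat n) (X : Mat r) :
    dot M (embed3 h X) = dot (block3 h M) X := by
  simp only [dot, ← (blockEquiv h).sum_comp, Fintype.sum_sum_type]
  simp [embed3, block3, toBlocks₂₂]

/-- Dilation and compression are adjoint, so constraints on points of the face become constraints on
`r × r` matrices. -/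
lemma dot_dilate (h : p + r = n) (Q M : Mat n) (X : Mat r) :
    dot M (dilate h Q X) = dot (compress h Q M) X := by
  rw [compress_apply, ← dot_embed3, dot_eq_trace, dot_eq_trace]
  change (Mᵀ * (Q * embed3 h X * Qᵀ)).trace = _
  rw [← mul_assoc, trace_mul_comm, transpose_mul, transpose_mul, transpose_transpose]
  simp only [mul_assoc]

lemma compress_dilate (h : p + r = n) {Q : Mat n} (hQ : Q ∈ orthogonalGroup (Fin n) ℝ)
    (X : Mat r) : compress h Q (dilate h Q X) = X := by
  have hQ' : Qᵀ * Q = 1 := (mem_orthogonalGroup_iff' (Fin n) ℝ).1 hQ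
  change block3 h (Qᵀ * (Q * embed3 h X * Qᵀ) * Q) = X
  rw [← mul_assoc, ← mul_assoc, hQ', one_mul, mul_assoc, hQ', mul_one]
  ext i j
  simp [block3, embed3, toBlocks₂₂]

lemma isSymm_compress (h : p + r = n) (Q : Mat n) {M : Mat n} (hM : M.IsSymm) :
    (compress h Q M).IsSymm := by
  have : (Qᵀ * M * Q).IsSymm := by
    rw [Matrix.IsSymm, transpose_mul, transpose_mul, transpose_transpose, hM.eq, mul_assoc]
  rw [compress_apply]
  ext i j
  exact congrFun (congrFun this _) _

lemma posSemidef_compress (h : p + r = n) (Q : Mat n) {M : Mat n} (hM : M.PosSemidef) :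
    (compress h Q M).PosSemidef := by
  have := hM.conjTranspose_mul_mul_same Q
  rw [conjTranspose_eq_transpose_of_trivial] at this
  exact (this.submatrix (blockEquiv h)).submatrix Sum.inr

/-! ### Faces and the minimal face -/

lemma convex_psdCone : Convex ℝ (psdCone n) := fun _ hX _ hY _ _ hs ht _ =>
  PosSemidef.add (PosSemidef.smul hX hs) (PosSemidef.smul hY ht)

lemma isFace_psdCone : IsFace (psdCone n) (psdCone n) :=
  ⟨subset_rfl, convex_psdCone, fun _ h₁ _ h₂ _ => ⟨h₁, h₂⟩⟩

/-- Pairing with `W` is nonnegative on the cone, so a positive combination of two such values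
vanishes only if both do. -/
lemma isFace_exposed {W : Mat n} (hW : W.PosSemidef) :
    IsFace (psdCone n) {X | X ∈ psdCone n ∧ dot W X = 0} := by
  refine ⟨fun _ h => h.1, fun X hX Y hY s t hs ht hst =>
    ⟨convex_psdCone hX.1 hY.1 hs ht hst, ?_⟩, ?_⟩
  · rw [dot_add_right, dot_smul_right, dot_smul_right, hX.2, hY.2, mul_zero, mul_zero, add_zero]
  · rintro X₁ h₁ X₂ h₂ ⟨_, ⟨s, t, hs, ht, -, rfl⟩, -, h0⟩
    have d₁ := dot_nonneg hW h₁
    have d₂ := dot_nonneg hW h₂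
    rw [dot_add_right, dot_smul_right, dot_smul_right] at h0
    have e₁ := mul_nonneg hs.le d₁
    have e₂ := mul_nonneg ht.le d₂
    exact ⟨⟨h₁, (mul_eq_zero.1 (by linarith)).resolve_left hs.ne'⟩,
      ⟨h₂, (mul_eq_zero.1 (by linarith)).resolve_left ht.ne'⟩⟩

lemma minFace_subset_psdCone (A : Fin m → Mat n) (b : Fin m → ℝ) : minFace A b ⊆ psdCone n :=
  Set.sInter_subset_of_mem ⟨isFace_psdCone, fun _ h => h.1⟩

lemma feasD_subset_minFace (A : Fin m → Mat n) (b : Fin m → ℝ) : feasD A b ⊆ minFace A b :=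
  Set.subset_sInter fun _ h => h.2

lemma mem_iff_of_representsFace {h : p + r = n} {Q : Mat n} {F : Set (Mat n)}
    (hF : RepresentsFace h Q F) {X : Mat n} :
    X ∈ F ↔ ∃ Y : Mat r, Y.PosSemidef ∧ X = dilate h Q Y := by
  rw [hF]; rfl

/-- A feasible point of a system whose feasible region lies in a represented face yields a
solution of the compressed system. -/
lemma exists_compressed_feasible {h : p + r = n} {Q : Mat n} {F : Set (Mat n)}
    (hF : RepresentsFace h Q F) {A : Fin m → Mat n} {b : Fin m → ℝ}
    (hfeas : (feasD A b).Nonempty) (hsub : minFace A b ⊆ F) :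
    ∃ Y : Mat r, Y.PosSemidef ∧ ∀ k, dot (compress h Q (A k)) Y = b k := by
  obtain ⟨X, hX⟩ := hfeas
  obtain ⟨Y, hY, rfl⟩ := (mem_iff_of_representsFace hF).1 (hsub (feasD_subset_minFace A b hX))
  exact ⟨Y, hY, fun k => by rw [← dot_dilate, hX.2 k]⟩

/-- The minimal face contains a feasible point in its relative interior. -/
theorem exists_posDef_of_minFace {h : p + r = n} {Q : Mat n}
    (hQ : Q ∈ orthogonalGroup (Fin n) ℝ) {A : Fin m → Mat n} {b : Fin m → ℝ}
    (hA : ∀ k, (A k).IsSymm) (hfeas : (feasD A b).Nonempty)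
    (hF : RepresentsFace h Q (minFace A b)) :
    ∃ Y : Mat r, Y.PosDef ∧ ∀ k, dot (compress h Q (A k)) Y = b k := by
  obtain ⟨Y₀, hY₀, hb⟩ := exists_compressed_feasible hF hfeas subset_rfl
  refine (exists_posDef_or_exists_reducing
    (fun k => isSymm_compress h Q (hA k)) hY₀ hb).resolve_right ?_
  rintro ⟨y, hpsd, hne, hby⟩
  set C := ∑ k, y k • compress h Q (A k) with hC
  have hW : (dilate h Q C).PosSemidef :=
    minFace_subset_psdCone A b ((mem_iff_of_representsFace hF).2 ⟨C, hpsd, rfl⟩)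
  have hdot : ∀ Y, dot (dilate h Q C) (dilate h Q Y) = dot C Y := fun Y => by
    rw [dot_dilate, compress_dilate h hQ]
  -- A reducing `y` would expose a face containing the feasible region, so the minimal face would
  -- lie in it; but the dilation of `1` pairs with `dilate h Q C` to `tr C`, nonzero since `C ≠ 0`.
  have hsub : minFace A b ⊆ {X | X ∈ psdCone n ∧ dot (dilate h Q C) X = 0} := by
    refine Set.sInter_subset_of_mem ⟨isFace_exposed hW, fun X hX => ⟨hX.1, ?_⟩⟩
    obtain ⟨Y, -, rfl⟩ := (mem_iff_of_representsFace hF).1 (feasD_subset_minFace A b hX)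
    rw [hdot, hC, dot_sum_smul_left, ← hby]
    exact Finset.sum_congr rfl fun k _ => by rw [← dot_dilate, hX.2 k, mul_comm]
  have h1 := (hsub ((mem_iff_of_representsFace hF).2 ⟨1, PosSemidef.one, rfl⟩)).2
  rw [hdot, dot_one] at h1
  exact hne (hpsd.trace_eq_zero_iff.1 h1)

/-- A represented face is contained in the minimal face of any system with a feasible point in
the relative interior of the face. -/
theorem subset_minFace_of_posDef {h : p + r = n} {Q : Mat n} {F : Set (Mat n)}
    (hF : RepresentsFace h Q F) (hFpsd : F ⊆ psdCone n) {A : Fin m → Mat n} {b : Fin m → ℝ}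
    {Y : Mat r} (hY : Y.PosDef) (hb : ∀ k, dot (compress h Q (A k)) Y = b k) :
    F ⊆ minFace A b := by
  have hmem : ∀ {Z : Mat r}, Z.PosSemidef → dilate h Q Z ∈ psdCone n := fun hZ =>
    hFpsd ((mem_iff_of_representsFace hF).2 ⟨_, hZ, rfl⟩)
  have hfeas : dilate h Q Y ∈ feasD A b :=
    ⟨hmem hY.posSemidef, fun k => by rw [dot_dilate, hb k]⟩
  refine fun X hX => Set.mem_sInter.2 fun G ⟨hG, hGsub⟩ => ?_
  obtain ⟨Z, hZ, rfl⟩ := (mem_iff_of_representsFace hF).1 hX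
  -- Prolong the segment from `Z` to `Y` slightly beyond `Y`, to `W = Y + ε(Y - Z)`. Then `Y = (ε Z
  -- + W) / (1 + ε)` is interior to the segment from `Z` to `W`, so a face containing the dilation
  -- of `Y` contains that of `Z`.
  obtain ⟨ε, hε, hW⟩ := exists_posSemidef_add_smul hY (N := Y - Z)
    ((isSymm_of_isHermitian hY.isHermitian).sub (isSymm_of_isHermitian hZ.isHermitian))
  refine (hG.2.2 _ (hmem hZ) _ (hmem hW) ⟨_, ?_, hGsub hfeas⟩).1
  refine ⟨ε / (1 + ε), 1 / (1 + ε), by positivity, by positivity, by field_simp; ring, ?_⟩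
  rw [← map_smul, ← map_smul, ← map_add]
  congr 1
  ext i j
  simp only [Matrix.add_apply, Matrix.smul_apply, Matrix.sub_apply, smul_eq_mul]
  field_simp
  ring

/-! ### Transfer to the compressed system and conclusion -/

/-- A combination in `(S^n_+ + F^⊥) \ F^⊥` compresses to a nonzero positive semidefinite matrix. -/
lemma compress_of_mem_diff {h : p + r = n} {Q : Mat n} {F : Set (Mat n)}
    (hF : RepresentsFace h Q F) {M : Mat n}
    (hM : M.IsSymm) (hmem : M ∈ (psdCone n + perp F) \ perp F) :
    (compress h Q M).PosSemidef ∧ compress h Q M ≠ 0 := by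
  obtain ⟨⟨P, hP, N, hN, rfl⟩, hnot⟩ := hmem
  refine ⟨?_, fun h0 => hnot ⟨hM, fun X hX => ?_⟩⟩
  -- The compression of `N` has zero quadratic form, hence is positive semidefinite, and its trace
  -- is zero by pairing `N` with the dilation of `1`.
  · have hN0 : compress h Q N = 0 := by
      have hz : ∀ x, x ⬝ᵥ compress h Q N *ᵥ x = 0 := fun x => by
        rw [← dot_vecMulVec, ← dot_dilate]
        exact hN.2 _ ((mem_iff_of_representsFace hF).2
          ⟨_, by simpa using posSemidef_vecMulVec_self_star x, rfl⟩)
      have hs := isSymm_compress h Q hN.1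
      refine (PosSemidef.trace_eq_zero_iff (posSemidef_of_isSymm hs fun x => (hz x).ge)).1 ?_
      rw [← dot_one, ← dot_dilate]
      exact hN.2 _ ((mem_iff_of_representsFace hF).2 ⟨_, PosSemidef.one, rfl⟩)
    change (compress h Q (P + N)).PosSemidef
    rw [map_add, hN0, add_zero]
    exact posSemidef_compress h Q hP
  · obtain ⟨Y, -, rfl⟩ := (mem_iff_of_representsFace hF).1 hX
    change compress h Q (P + N) = 0 at h0
    change dot (P + N) _ = 0
    rw [dot_dilate, h0]
    simp [dot]

end SDP

theorem lemma4p1 {n m : ℕ}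
    (A₀ : SDP.Mat n) (A : Fin m → SDP.Mat n) (b : Fin m → ℝ) (E : Fin m → ℝ → SDP.Mat n)
    (hA₀ : A₀.IsSymm) (hA : ∀ k, (A k).IsSymm)
    (hE : ∀ k, ∀ t : ℝ, 0 ≤ t → (E k t).IsSymm)
    (hE0 : ∀ k, E k 0 = 0)
    (hEcont : ∀ k, ContinuousWithinAt (E k) (Set.Ici 0) 0)
    (hD : (SDP.feasD A b).Nonempty) (hP : SDP.StrictlyFeasibleP A₀ A)
    (hlin : LinearIndependent ℝ A)
    (hDt : ∀ᶠ t in nhdsWithin (0 : ℝ) (Set.Ioi 0),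
      (SDP.feasD (fun k => A k + E k t) b).Nonempty)
    (hrank : SDP.RankCondition A b E)
    (hsub : ∀ᶠ t in nhdsWithin (0 : ℝ) (Set.Ioi 0),
      SDP.minFace (fun k => A k + E k t) b ⊆ SDP.minFace A b) :
    ∀ᶠ t in nhdsWithin (0 : ℝ) (Set.Ioi 0),
      (¬ ∃ y : Fin m → ℝ,
        (∑ k, y k • (A k + E k t)) ∈
          (SDP.psdCone n + SDP.perp (SDP.minFace A b)) \ SDP.perp (SDP.minFace A b) ∧
        ∑ k, b k * y k = 0) ∧
      SDP.minFace (fun k => A k + E k t) b = SDP.minFace A b := by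
  obtain ⟨p, r, h, Q, hQ, hF, δ, hδ, hrk⟩ := hrank
  obtain ⟨Y₀, hY₀, hb⟩ := SDP.exists_posDef_of_minFace hQ hA hD hF
  have hlim : Filter.Tendsto (fun t k => SDP.compress h Q (A k + E k t))
      (nhdsWithin (0 : ℝ) (Set.Ioi 0)) (nhds fun k => SDP.compress h Q (A k)) := by
    refine tendsto_pi_nhds.2 fun k => ?_
    have hc : Filter.Tendsto (E k) (nhdsWithin (0 : ℝ) (Set.Ioi 0)) (nhds 0) := by
      simpa only [ContinuousWithinAt, hE0 k] using (hEcont k).mono Set.Ioi_subset_Ici_self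
    have hcomp := (LinearMap.continuous_of_finiteDimensional (SDP.compress h Q)).tendsto (A k + 0)
    simpa only [add_zero, Function.comp_def] using hcomp.comp (hc.const_add (A k))
  have hfeas : ∀ᶠ t in nhdsWithin (0 : ℝ) (Set.Ioi 0), ∃ Y : SDP.Mat r, Y.PosSemidef ∧
      ∀ k, SDP.dot (SDP.compress h Q (A k + E k t)) Y = b k := by
    filter_upwards [hDt, hsub] with t h₁ h₂
    exact SDP.exists_compressed_feasible hF h₁ h₂
  have hrk' : ∀ᶠ t in nhdsWithin (0 : ℝ) (Set.Ioi 0),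
      SDP.rankSpan (fun k => SDP.compress h Q (A k + E k t)) =
        SDP.rankSpan (fun k => SDP.compress h Q (A k)) := by
    filter_upwards [Ioo_mem_nhdsGT hδ] with t ht
    exact hrk t ht.1.le ht.2.le
  have hno := SDP.eventually_not_exists_reducing (fun k => SDP.isSymm_compress h Q (hA k)) hlim
    hrk' hY₀ hb (hfeas.mono fun t ⟨Y, _, hY⟩ => ⟨Y, hY⟩)
  filter_upwards [hno, hfeas, hsub, self_mem_nhdsWithin] with t hnot ⟨Y, hY, hYb⟩ hsubt ht
  have hsymm : ∀ k, (A k + E k t).IsSymm := fun k => (hA k).add (hE k t (le_of_lt ht))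
  refine ⟨?_, hsubt.antisymm ?_⟩
  · rintro ⟨y, hy, hby⟩
    have hc := SDP.compress_of_mem_diff hF (SDP.isSymm_sum_smul hsymm y) hy
    simp only [map_sum, map_smul] at hc
    exact hnot ⟨y, hc.1, hc.2, hby⟩
  · obtain ⟨Y', hY', hb'⟩ := (SDP.exists_posDef_or_exists_reducing
      (fun k => SDP.isSymm_compress h Q (hsymm k)) hY hYb).resolve_right hnot
    exact SDP.subset_minFace_of_posDef hF (SDP.minFace_subset_psdCone A b) hY' hb'
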